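/- Let $p$ be a prime number and let $R$ be a commutative unital $\overline{\mathbb F}_p$-algebra. Notation. Let $\mathbb ZR$ be the semigroup algebra of $(R,\cdot)$, i.e. the free abelian group on symbols $[r]$, $r\in R$, with $[r][s]=[rs]$, considered as a discrete ring. Let $I$ be the kernel of the ring homomorphism $\mathbb ZR\to R$, $[r]\mapsto r$, let $\phi$ be the ring endomorphism of $\mathbb ZR$ with $\phi([r])=[r^p]$, and for $n\ge 1$ put $I_n=\phi^{1-n}(I^n)=\{a\in\mathbb ZR\mid \phi^{n-1}(a)\in I^n\}$. For a commutative ring $A$ (with the discrete topology), an ideal $J\subset A$ and an index set $S=\{0,1,2,\dots\}$ or $S=\{0,\dots,n-1\}$, let $X_S(J)\subset A^S$ be the closed additive subgroup (product topology) generated by the elements $V^i\langle a\rangle=p^i(0,\dots,0,a,a^p,a^{p^2},\dots)$ ($a$ in place $i$), $a\in J$, $i\in S$. Then $X_S(A)$ is a closed subring of $A^S$ and $X_S(J)$ is an ideal of it. Put $E_S(R)=X_S(\mathbb ZR)/X_S(I)$ with the quotient topology; write $E(R)$ for $S=\{0,1,2,\dots\}$ and $E_n(R)$ for $S=\{0,\dots,n-1\}$.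 For $r\in R$ let $V^i\langle r\rangle\in E_S(R)$ be the class of $V^i\langle[r]\rangle$, and let $\alpha:\mathbb ZR\to E_S(R)$ be the ring homomorphism with $\alpha([r])=V^0\langle r\rangle$. Let $W(R)$ be the ring of $p$-typical Witt vectors (with the product topology of $R^{\mathbb N_0}$, $R$ discrete) and $W_n(R)$ the ring of Witt vectors of length $n$. There are isomorphisms of rings $E_n(R)\cong W_n(R)$, $n\ge1$, and an isomorphism of topological rings $E(R)\cong W(R)$, sending $V^i\langle r\rangle$ to $V^i$ of the Teichmüller representative of $r$; under these, $\alpha$ corresponds to the ring homomorphism sending $[r]$ to the Teichmüller representative of $r$. Theorem. For every $n\ge 1$ the natural map $\alpha:\mathbb ZR\to E_n(R)\cong W_n(R)$ is surjective. If in addition the Frobenius endomorphism $r\mapsto r^p$ of $R$ is injective, then $I_1\supseteq I_2\supseteq\cdots$, and for every $n\ge 1$ the map $\alpha$ induces an isomorphism of rings $$\beta_n:\mathbb ZR/I_n\xrightarrow{\ \sim\ }E_n(R)\cong W_n(R).$$ In this case $\alpha$ induces an isomorphism of topological rings $$\hat\alpha:\varprojlim_n\mathbb ZR/I_n\xrightarrow{\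 \sim\ }E(R)\cong W(R),$$ where the rings $\mathbb ZR/I_n$ are discrete and the limit carries the projective limit topology; its composition with the projection to $E_n(R)\cong W_n(R)$ is the projection to $\mathbb ZR/I_n$ followed by $\beta_n$, for every $n\ge1$. -/

import Mathlib

namespace CuntzDeninger

/-! ### The rings `X_S(A)` and the ideals `X_S(I)`

The truncation sets `{1, p, p ^ 2, …}` and `{1, p, …, p ^ (n - 1)}` are indexed by exponents: a
truncation set is a lower set `S` of `ℕ`, namely `⊤` (all of `ℕ`) or `LowerSet.Iio n`
(the exponents `k < n`). -/

section X

variable (p : ℕ) (S : LowerSet ℕ) {A : Type*} [CommRing A]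

/-- `V ^ n ⟨a⟩ = p ^ n (0, …, 0, a, a ^ p, a ^ (p ^ 2), …)` in `A ^ S`, with `a` in place `n`.
It vanishes when `n ∉ S`. -/
def verTeich (n : ℕ) (a : A) : S → A :=
  fun k => if n ≤ (k : ℕ) then (p : A) ^ n * a ^ p ^ ((k : ℕ) - n) else 0

theorem verTeich_zero_one : verTeich p S 0 (1 : A) = 1 := by
  funext k
  simp [verTeich]

theorem verTeich_zero_mul (a b : A) :
    verTeich p S 0 (a * b) = verTeich p S 0 a * verTeich p S 0 b := by
  funext k
  simp [verTeich, mul_pow]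

theorem verTeich_mul_verTeich {n m : ℕ} (h : n ≤ m) (b c : A) :
    verTeich p S n b * verTeich p S m c = p ^ n • verTeich p S m (b ^ p ^ (m - n) * c) := by
  funext k
  simp only [verTeich, Pi.mul_apply, Pi.smul_apply]
  by_cases hm : m ≤ (k : ℕ)
  · have hn : n ≤ (k : ℕ) := h.trans hm
    have e : (k : ℕ) - n = (m - n) + ((k : ℕ) - m) := by omega
    rw [if_pos hn, if_pos hm, if_pos hm, e, pow_add p, pow_mul b, mul_pow, nsmul_eq_mul]
    push_cast
    ring
  · simp [hm]

/-- The additive subgroup of `A ^ S` generated by the elements `V ^ n ⟨a⟩` with `n ≥ 0`, `a ∈ I`. -/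
def preX (I : Ideal A) : AddSubgroup (S → A) :=
  AddSubgroup.closure {x | ∃ n : ℕ, ∃ a ∈ I, x = verTeich p S n a}

theorem preX_mul_mem (hp : 0 < p) (I : Ideal A) {x y : S → A} (hx : x ∈ preX p S (⊤ : Ideal A))
    (hy : y ∈ preX p S I) : x * y ∈ preX p S I := by
  refine AddSubgroup.closure_induction (p := fun x _ => x * y ∈ preX p S I) ?_ ?_ ?_ ?_ hx
  · rintro x ⟨n, b, -, rfl⟩
    refine AddSubgroup.closure_induction
      (p := fun y _ => verTeich p S n b * y ∈ preX p S I) ?_ ?_ ?_ ?_ hy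
    · rintro y ⟨m, c, hc, rfl⟩
      rcases le_total n m with h | h
      · rw [verTeich_mul_verTeich p S h]
        exact (preX p S I).nsmul_mem
          (AddSubgroup.subset_closure ⟨m, _, I.mul_mem_left _ hc, rfl⟩) _
      · rw [mul_comm, verTeich_mul_verTeich p S h]
        exact (preX p S I).nsmul_mem (AddSubgroup.subset_closure ⟨n, _, I.mul_mem_right _
          (I.pow_mem_of_mem hc _ (pow_pos hp _)), rfl⟩) _
    · simp [zero_mem]
    · intro y z _ _ h1 h2
      rw [mul_add]
      exact add_mem h1 h2
    · intro y _ h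
      rw [mul_neg]
      exact neg_mem h
  · simp [zero_mem]
  · intro x z _ _ h1 h2
    rw [add_mul]
    exact add_mem h1 h2
  · intro x _ h
    rw [neg_mul]
    exact neg_mem h

/-- The restriction `A ^ S → A ^ T` for truncation sets `T ≤ S`. -/
def restr (A : Type*) [CommRing A] {S T : LowerSet ℕ} (h : T ≤ S) : (S → A) →+* (T → A) :=
  RingHom.pi fun k => Pi.evalRingHom _ ⟨k, h k.2⟩

variable [TopologicalSpace A] [DiscreteTopology A]

/-- `X_S(I)` for an ideal `I` of the discrete ring `A`: the closed additive subgroup of `A ^ S`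
(with the product topology) generated by the elements `V ^ n ⟨a⟩` with `n ≥ 0` and `a ∈ I`. -/
def X (I : Ideal A) : AddSubgroup (S → A) :=
  (preX p S I).topologicalClosure

theorem verTeich_mem_X {I : Ideal A} (n : ℕ) {a : A} (ha : a ∈ I) : verTeich p S n a ∈ X p S I :=
  AddSubgroup.le_topologicalClosure _ (AddSubgroup.subset_closure ⟨n, a, ha, rfl⟩)

theorem restr_mem_X {S T : LowerSet ℕ} (h : T ≤ S) (I : Ideal A) {x : S → A} (hx : x ∈ X p S I) :
    restr A h x ∈ X p T I := by
  have hc : Continuous (restr A h) := continuous_pi fun k => continuous_apply _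
  refine map_mem_closure (s := (preX p S I : Set (S → A))) (t := (preX p T I : Set (T → A)))
    hc hx fun y hy => ?_
  have hle : preX p S I ≤ (preX p T I).comap (restr A h).toAddMonoidHom := by
    refine (AddSubgroup.closure_le _).2 ?_
    rintro _ ⟨n, a, ha, rfl⟩
    exact AddSubgroup.subset_closure ⟨n, a, ha, rfl⟩
  exact hle hy

variable [hp : Fact p.Prime]

theorem X_mul_mem (I : Ideal A) {x y : S → A} (hx : x ∈ X p S (⊤ : Ideal A))
    (hy : y ∈ X p S I) : x * y ∈ X p S I :=
  map_mem_closure₂ continuous_mul hx hy fun _ ha _ hb => preX_mul_mem p S hp.out.pos I ha hb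

variable (A) in
/-- `X_S(A)`, a closed subring of `A ^ S`. -/
def XRing : Subring (S → A) where
  __ := X p S (⊤ : Ideal A)
  mul_mem' hx hy := X_mul_mem p S ⊤ hx hy
  one_mem' := verTeich_zero_one p S (A := A) ▸ verTeich_mem_X p S 0 Submodule.mem_top

/-- `X_S(I)` as an ideal of the ring `X_S(A)`. -/
def XIdeal (I : Ideal A) : Ideal (XRing p S A) where
  carrier := {x | (x : S → A) ∈ X p S I}
  add_mem' hx hy := (X p S I).add_mem hx hy
  zero_mem' := (X p S I).zero_mem
  smul_mem' c _ hx := X_mul_mem p S I c.2 hx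

/-- The restriction `X_S(A) → X_T(A)` for truncation sets `T ≤ S`. -/
def XRing.proj {S T : LowerSet ℕ} (h : T ≤ S) : XRing p S A →+* XRing p T A :=
  (restr A h).restrict (XRing p S A) (XRing p T A) fun _ hx => restr_mem_X p h ⊤ hx

end X

/-! ### The semigroup algebra `ℤR` and the ideals `I` and `I_n` -/

section ZR

variable (p : ℕ) (R : Type*) [CommRing R]

/-- The semigroup algebra `ℤR` of the multiplicative semigroup of `R`: the free abelian group on the
symbols `[r]`, `r ∈ R` (including `[0]`), with `[r] [s] = [r s]`. -/
abbrev ZR : Type _ := MonoidAlgebra ℤ R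

/-- `ℤR` is viewed as a discrete ring. -/
instance instTopologicalSpaceZR : TopologicalSpace (ZR R) := ⊥

instance instDiscreteTopologyZR : DiscreteTopology (ZR R) := ⟨rfl⟩

/-- The ring homomorphism `ℤR → B` with `[r] ↦ f r` induced by a multiplicative map `f : R → B`. -/
noncomputable def liftZR {R : Type*} [CommRing R] {B : Type*} [CommRing B] (f : R →* B) :
    ZR R →+* B :=
  (MonoidAlgebra.lift ℤ B R f).toRingHom

/-- The kernel `I` of the natural map `π : ℤR → R`, `[r] ↦ r`. -/
noncomputable def augIdeal : Ideal (ZR R) :=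
  RingHom.ker (liftZR (MonoidHom.id R))

/-- The endomorphism `φ` of `ℤR` with `φ [r] = [r ^ p]`. -/
noncomputable def frobZR : ZR R →+* ZR R :=
  MonoidAlgebra.mapDomainRingHom ℤ (powMonoidHom p : R →* R)

/-- The ideal `I_n = φ ^ (1 - n) (I ^ n) = {a | φ ^ (n - 1) a ∈ I ^ n}` of `ℤR`, for `n ≥ 1`. -/
noncomputable def frobIdeal (n : ℕ+) : Ideal (ZR R) :=
  (augIdeal R ^ (n : ℕ)).comap (frobZR p R ^ ((n : ℕ) - 1))

end ZR

/-! ### The rings `E_S(R)` -/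

section E

variable (p : ℕ) [hp : Fact p.Prime] (S : LowerSet ℕ) (R : Type*) [CommRing R]

/-- The ring `E_S(R) = X_S(ℤR) / X_S(I)`. It carries the quotient topology, as does every
quotient of a topological ring. -/
abbrev E : Type _ := XRing p S (ZR R) ⧸ XIdeal p S (augIdeal R)

/-- The ring `E_n(R)`, belonging to the truncation set `{1, p, …, p ^ (n - 1)}`. -/
abbrev En (n : ℕ) : Type _ := E p (LowerSet.Iio n) R

/-- The ring `E(R)`, belonging to the truncation set `{1, p, p ^ 2, …}`. -/
abbrev EInf : Type _ := E p ⊤ R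

variable {R}

/-- The element `V ^ i ⟨r⟩` of `E_S(R)`, the class of `V ^ i ⟨[r]⟩`. -/
noncomputable def verTeichE (i : ℕ) (r : R) : E p S R :=
  Ideal.Quotient.mk _ ⟨verTeich p S i (MonoidAlgebra.of ℤ R r),
    verTeich_mem_X p S i Submodule.mem_top⟩

/-- The multiplicative Teichmüller map `R → E_S(R)`, `r ↦ ⟨r⟩`. -/
noncomputable def teichE : R →* E p S R where
  toFun r := verTeichE p S 0 r
  map_one' := by
    rw [verTeichE, ← map_one (Ideal.Quotient.mk (XIdeal p S (augIdeal R)))]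
    congr 1
    ext1
    exact (congrArg _ (map_one (MonoidAlgebra.of ℤ R))).trans (verTeich_zero_one p S)
  map_mul' r s := by
    rw [verTeichE, verTeichE, verTeichE, ← map_mul]
    congr 1
    ext1
    exact (congrArg _ (map_mul (MonoidAlgebra.of ℤ R) r s)).trans (verTeich_zero_mul p S _ _)

variable (R)

/-- The ring homomorphism `α : ℤR → E_S(R)` with `[r] ↦ ⟨r⟩`. -/
noncomputable def alpha : ZR R →+* E p S R :=
  liftZR (teichE p S)

/-- The projection `E_S(R) → E_T(R)` for truncation sets `T ≤ S`. -/
noncomputable def projE {S T : LowerSet ℕ} (h : T ≤ S) : E p S R →+* E p T R :=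
  Ideal.quotientMap _ (XRing.proj p h) fun _ hx => restr_mem_X p h (augIdeal R) hx

end E

/-! ### Witt vectors -/

section Witt

variable (p : ℕ) [hp : Fact p.Prime] (R : Type*) [CommRing R]

/-- The topology of `W(R)`: the product topology of `R ^ ℕ` with `R` discrete, that is, the
projective limit topology of the discrete rings `W_n(R)`. -/
instance instTopologicalSpaceWitt : TopologicalSpace (WittVector p R) :=
  TopologicalSpace.induced (fun x k => x.coeff k)
    (@Pi.topologicalSpace ℕ (fun _ => R) fun _ => ⊥)

/-- The natural map `ℤR → W(R)` sending `[r]` to the Teichmüller representative of `r`. -/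
noncomputable def alphaW : ZR R →+* WittVector p R :=
  liftZR (WittVector.teichmuller p)

/-- The natural map `ℤR → W_n(R)`. -/
noncomputable def alphaWn (n : ℕ) : ZR R →+* TruncatedWittVector p n R :=
  (WittVector.truncate n).comp (alphaW p R)

end Witt

/-! ### Projective limits -/

/-- The projective limit of the rings `A / J i`, for a decreasing family of ideals `J i`, as a
subring of the product. It has the subspace topology of the product of the quotient topologies
(which are discrete for discrete `A`). -/
def quotLim {ι : Type*} [Preorder ι] {A : Type*} [CommRing A] (J : ι → Ideal A)
    (hJ : Antitone J) : Subring (∀ i, A ⧸ J i) where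
  carrier := {x | ∀ i j, ∀ h : i ≤ j, Ideal.Quotient.factor (hJ h) (x j) = x i}
  mul_mem' hx hy i j h := by simp [hx i j h, hy i j h]
  one_mem' i j h := by simp
  add_mem' hx hy i j h := by simp [hx i j h, hy i j h]
  zero_mem' i j h := by simp
  neg_mem' hx i j h := by simp [hx i j h]

end CuntzDeninger

/-! The theorem rests on the identification of `E_S(R)` with Witt vectors and on descriptions of the
image and the kernel of the ring homomorphism `ℤR → W_n(R)` given by Teichmüller representatives.

*Identification.* The element `V ^ i ⟨a⟩` of `A ^ S` is the ghost vector of `V ^ i [a]`. If `A` is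
`p`-torsion free, as `A = ℤR` is, the ghost components with index in `S` determine the coefficients
with index in `S` one after the other. Hence the ghost map has closed image, and `X_S(J)` is the
image of the Witt vectors with coefficients in `J` (`mem_X_iff`). So `W(ℤR) → E_S(R)` is surjective,
and its kernel consists of the Witt vectors whose coefficients with index in `S` lie in `I`
(`wittToE_eq_zero_iff`). For `S = {0, …, n - 1}` this is the kernel of `W(ℤR) → W_n(R)`, and for
`S = ℕ` the kernel of `W(ℤR) → W(R)`.

*Image.* Filtering by powers of `V`, it suffices to write `V ^ n [r]` modulo `V ^ (n + 1)` as a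
combination of Teichmüller representatives. This is done in `W(k[X])` for an infinite perfect field
`k` (`exists_iterate_verschiebung_teichmuller_X`): modulo `V ^ (n + 1)` one has
`F ^ n [1 + l X] = [1 + l X] ^ (p ^ n) ≡ (1 + [l] [X]) ^ (p ^ n)`, a polynomial in `[l]` whose linear
term is `p ^ n [X] [l] = F ^ n (V ^ n [X]) [l]`. Interpolation at `p ^ n + 1` values of `l`, possible
because the Vandermonde determinant is a unit of `W(k)`, isolates this term, and `F` is injective
modulo `V ^ (n + 1)`. The weights lie in `W(k)` and are themselves combinations of Teichmüller
representatives modulo `V ^ (n + 1)`, as `k` is perfect.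

*Kernel.* Lift `ℤR → W(R)` to `ℤR → W(ℤR)`, `[r] ↦ [[r]]`; the ghost components of the lift of `a`
are `a, φ a, φ ^ 2 a, …`. If `a` dies in `W_n(R)`, the coefficients `w_i`, `i < n`, of its lift lie
in `I`, and `φ ^ (n - 1) a = ∑ p ^ i w_i ^ (p ^ (n - 1 - i))` is in `I ^ n` because `p ∈ I`
(`frobZR_pow_mem_of_alphaWn_eq_zero`). Conversely `I` maps to `V W(R)`, so `I ^ n` maps to
`V ^ n W(R)`, and `φ` corresponds to `F`, which is injective modulo `V ^ n` if the Frobenius of `R`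
is injective. Hence `I_n` is the kernel (`frobIdeal_eq_ker`), and passing to the limit gives the
last assertion (`exists_quotLim_ringEquiv`). -/

namespace CuntzDeninger

/-! ### Topology of the products `A ^ S` and of `W(R)` -/

section Topology

theorem isOpen_agree (S : LowerSet ℕ) {A : Type*} [TopologicalSpace A] [DiscreteTopology A]
    (x : S → A) (n : ℕ) :
    IsOpen {y : S → A | ∀ k : S, (k : ℕ) ≤ n → y k = x k} := by
  have hf : {k : S | (k : ℕ) ≤ n}.Finite :=
    Set.Finite.preimage Subtype.val_injective.injOn (Set.finite_Iic n)
  have : {y : S → A | ∀ k : S, (k : ℕ) ≤ n → y k = x k} =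
      ⋂ k ∈ {k : S | (k : ℕ) ≤ n}, (fun y : S → A => y k) ⁻¹' {x k} := by
    ext y
    simp
  rw [this]
  exact hf.isOpen_biInter fun k _ => (isOpen_discrete _).preimage (continuous_apply k)

/-- A map into `W(R)` is continuous if each coefficient is locally constant. -/
theorem continuous_witt_rng {p : ℕ} {R Y : Type*}
    [TopologicalSpace Y] {f : Y → WittVector p R}
    (h : ∀ k, IsLocallyConstant fun y => (f y).coeff k) : Continuous f := by
  let : TopologicalSpace R := ⊥
  refine continuous_induced_rng.2 (continuous_pi fun k => (h k).continuous)

/-- A function of finitely many coefficients is locally constant on `W(R)`. -/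
theorem isLocallyConstant_witt {p : ℕ} {R Z : Type*} {f : WittVector p R → Z} (n : ℕ)
    (h : ∀ x y : WittVector p R, (∀ i ≤ n, x.coeff i = y.coeff i) → f x = f y) :
    IsLocallyConstant f := by
  let : TopologicalSpace R := ⊥
  have : DiscreteTopology R := ⟨rfl⟩
  have hc : ∀ k, Continuous fun x : WittVector p R => x.coeff k := fun k =>
    (continuous_apply k).comp continuous_induced_dom
  refine (IsLocallyConstant.iff_exists_open f).2 fun x =>
    ⟨⋂ i ∈ Set.Iic n, (fun y : WittVector p R => y.coeff i) ⁻¹' {x.coeff i},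
      (Set.finite_Iic n).isOpen_biInter fun i _ => (isOpen_discrete _).preimage (hc i),
      by simp, fun y hy => h y x fun i hi => ?_⟩
  simp only [Set.mem_iInter] at hy
  exact hy i hi

end Topology

/-! ### The ghost map and the groups `X_S(I)` -/

section Ghost

variable (p : ℕ) [hp : Fact p.Prime] (S : LowerSet ℕ) {A : Type*} [CommRing A]

/-- The ghost map `W(A) → A ^ S`, keeping only the ghost components with index in `S`. -/
noncomputable def ghost : WittVector p A →+* (S → A) :=
  RingHom.pi fun k => WittVector.ghostComponent (k : ℕ)

theorem ghost_apply (w : WittVector p A) (k : S) :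
    ghost p S w k = ∑ i ∈ Finset.range ((k : ℕ) + 1), (p : A) ^ i * w.coeff i ^ p ^ ((k : ℕ) - i) := by
  rw [← aeval_wittPolynomial p ℤ, ← WittVector.ghostComponent_apply]
  rfl

theorem iterate_verschiebung_teichmuller_coeff (i : ℕ) (a : A) (j : ℕ) :
    (WittVector.verschiebung^[i] (WittVector.teichmuller p a)).coeff j = if j = i then a else 0 := by
  rcases lt_or_ge j i with h | h
  · rw [WittVector.iterate_verschiebung_coeff_eq_zero _ h, if_neg h.ne]
  · obtain ⟨m, rfl⟩ := Nat.exists_eq_add_of_le' h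
    rw [WittVector.iterate_verschiebung_coeff]
    rcases Nat.eq_zero_or_pos m with rfl | hm
    · simp [WittVector.teichmuller_coeff_zero]
    · rw [WittVector.teichmuller_coeff_pos _ _ _ hm, if_neg (by omega)]

theorem ghost_iterate_verschiebung_teichmuller (i : ℕ) (a : A) :
    ghost p S (WittVector.verschiebung^[i] (WittVector.teichmuller p a)) = verTeich p S i a := by
  funext k
  rw [ghost_apply, verTeich]
  have h0 : ∀ j, p ^ ((k : ℕ) - j) ≠ 0 := fun j => (pow_pos hp.out.pos _).ne'
  simp only [iterate_verschiebung_teichmuller_coeff, ite_pow, zero_pow (h0 _), mul_ite, mul_zero]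
  rw [Finset.sum_ite_eq']
  simp

variable {p S}

theorem ghost_congr {x y : WittVector p A} (k : S)
    (h : ∀ i ≤ (k : ℕ), x.coeff i = y.coeff i) : ghost p S x k = ghost p S y k := by
  rw [ghost_apply, ghost_apply]
  refine Finset.sum_congr rfl fun i hi => ?_
  rw [h i (by simpa [Nat.lt_succ_iff] using hi)]

/-- Over a `p`-torsion free ring the coefficient `n` of a Witt vector is determined by its ghost
components with index at most `n`. -/
theorem coeff_eq_of_ghost_eq (hA : (p : A) ∈ nonZeroDivisors A) {x y : WittVector p A} (n : ℕ)
    (hn : n ∈ S) (h : ∀ k : S, (k : ℕ) ≤ n → ghost p S x k = ghost p S y k) :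
    x.coeff n = y.coeff n := by
  induction n using Nat.strong_induction_on with
  | _ n ih =>
    have h1 : ∀ i < n, x.coeff i = y.coeff i := fun i hi =>
      ih i hi (S.lower hi.le hn) fun k hk => h k (hk.trans hi.le)
    have h2 := h ⟨n, hn⟩ le_rfl
    rw [ghost_apply, ghost_apply, Finset.sum_range_succ, Finset.sum_range_succ,
      Finset.sum_congr rfl fun i hi => by rw [h1 i (Finset.mem_range.1 hi)]] at h2
    simp only [add_right_inj, Nat.sub_self, pow_zero, pow_one] at h2
    exact (mul_cancel_left_mem_nonZeroDivisors (pow_mem hA n)).1 h2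

variable (p S)

theorem preX_subset_ghost (I : Ideal A) {x : S → A} (hx : x ∈ preX p S I) :
    ∃ w : WittVector p A, (∀ i, w.coeff i ∈ I) ∧ ghost p S w = x := by
  -- the Witt vectors with coefficients in `I` are the kernel of `W(A) → W(A / I)`
  have hK : ∀ w : WittVector p A, (∀ i, w.coeff i ∈ I) ↔
      w ∈ RingHom.ker (WittVector.map (p := p) (Ideal.Quotient.mk I)) := fun w => by
    simp [RingHom.mem_ker, WittVector.ext_iff, WittVector.map_coeff, Ideal.Quotient.eq_zero_iff_mem]
  simp only [hK]
  have hle : preX p S I ≤ (RingHom.ker (WittVector.map (p := p)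
      (Ideal.Quotient.mk I))).toAddSubgroup.map (ghost p S).toAddMonoidHom := by
    refine (AddSubgroup.closure_le _).2 ?_
    rintro _ ⟨n, a, ha, rfl⟩
    refine ⟨_, (hK _).1 fun j => ?_, ghost_iterate_verschiebung_teichmuller p S n a⟩
    rw [iterate_verschiebung_teichmuller_coeff]
    split_ifs
    exacts [ha, I.zero_mem]
  exact hle hx

/-- A finite sum of elements `V ^ i ⟨w_i⟩` approximates the ghost vector of `w`. -/
theorem sum_verTeich_apply (w : ℕ → A) (n : ℕ) (k : S) (hk : (k : ℕ) < n) :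
    (∑ i ∈ Finset.range n, verTeich p S i (w i)) k = ghost p S (WittVector.mk p w) k := by
  rw [ghost_apply, Finset.sum_apply]
  simp only [verTeich, ← Finset.sum_filter]
  refine Finset.sum_congr (Finset.ext fun i => ?_) fun _ _ => rfl
  simp only [Finset.mem_filter, Finset.mem_range]
  omega

variable [TopologicalSpace A] [DiscreteTopology A]

/-- Over a `p`-torsion free ring, `X_S(I)` is the image under the ghost map of the Witt vectors with
coefficients in `I`. The image is closed because coefficients depend on finitely many ghost
components, and the elements `V ^ i ⟨a⟩` generate a dense subgroup because of
`w = ∑ V ^ i [w_i]`. -/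
theorem mem_X_iff (hA : (p : A) ∈ nonZeroDivisors A) (I : Ideal A) (x : S → A) :
    x ∈ X p S I ↔ ∃ w : WittVector p A, (∀ i, w.coeff i ∈ I) ∧ ghost p S w = x := by
  constructor
  · intro hx
    have h : ∀ n : ℕ, ∃ w : WittVector p A, (∀ i, w.coeff i ∈ I) ∧
        ∀ k : S, (k : ℕ) ≤ n → ghost p S w k = x k := fun n => by
      obtain ⟨y, hy, hyp⟩ := mem_closure_iff.1 hx _ (isOpen_agree S x n) fun _ _ => rfl
      obtain ⟨w, hw, rfl⟩ := preX_subset_ghost p S I hyp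
      exact ⟨w, hw, hy⟩
    choose w hwI hw using h
    refine ⟨WittVector.mk p fun i => (w i).coeff i, fun i => hwI i i, funext fun k => ?_⟩
    rw [← hw k k le_rfl]
    refine ghost_congr k fun i hi => ?_
    rw [WittVector.coeff_mk]
    refine coeff_eq_of_ghost_eq (S := S) hA i (S.lower hi k.2) fun l hl => ?_
    rw [hw i l hl, hw k l (hl.trans hi)]
  · rintro ⟨w, hw, rfl⟩
    refine mem_closure_iff.2 fun U hU hxU => ?_
    obtain ⟨J, u, hu, hJ⟩ := isOpen_pi_iff.1 hU _ hxU
    refine ⟨∑ i ∈ Finset.range (J.sup (fun k => (k : ℕ)) + 1), verTeich p S i (w.coeff i),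
      hJ fun k hk => ?_, sum_mem fun i _ => AddSubgroup.subset_closure ⟨i, _, hw i, rfl⟩⟩
    rw [sum_verTeich_apply p S _ _ k
      (Nat.lt_succ_of_le (Finset.le_sup (f := fun k : S => (k : ℕ)) hk))]
    exact (hu k hk).2

/-- The ghost map as a ring homomorphism `W(A) → X_S(A)`. -/
noncomputable def ghostX (hA : (p : A) ∈ nonZeroDivisors A) : WittVector p A →+* XRing p S A :=
  (ghost p S).codRestrict _ fun w =>
    (mem_X_iff p S hA ⊤ (ghost p S w)).2 ⟨w, fun _ => Submodule.mem_top, rfl⟩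

theorem ghostX_surjective (hA : (p : A) ∈ nonZeroDivisors A) :
    Function.Surjective (ghostX p S hA) := by
  rintro ⟨x, hx⟩
  obtain ⟨w, -, rfl⟩ := (mem_X_iff p S hA ⊤ x).1 hx
  exact ⟨w, rfl⟩

end Ghost

/-! ### The isomorphisms `E_n(R) ≅ W_n(R)` and `E(R) ≅ W(R)` -/

section Comparison

variable (p : ℕ) [hp : Fact p.Prime] (R : Type*) [CommRing R]

theorem natCast_prime_mem_nonZeroDivisors_ZR : (p : ZR R) ∈ nonZeroDivisors (ZR R) := by
  rw [mem_nonZeroDivisors_iff_right]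
  intro a ha
  rw [mul_comm, ← nsmul_eq_mul] at ha
  ext r
  have := congrArg (fun b : ZR R => b.coeff r) ha
  rw [MonoidAlgebra.coeff_smul, Finsupp.smul_apply, nsmul_eq_mul] at this
  exact (mul_eq_zero.1 this).resolve_left (Nat.cast_ne_zero.2 hp.out.ne_zero)

/-- The natural map `π : ℤR → R`, `[r] ↦ r`. -/
noncomputable abbrev piZR : ZR R →+* R := liftZR (MonoidHom.id R)

variable {R} in
theorem liftZR_of {B : Type*} [CommRing B] (f : R →* B) (r : R) :
    liftZR f (MonoidAlgebra.of ℤ R r) = f r :=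
  MonoidAlgebra.lift_of f r

variable {R} in
theorem ZR_hom_ext {B : Type*} [CommRing B] {f g : ZR R →+* B}
    (h : ∀ r, f (MonoidAlgebra.of ℤ R r) = g (MonoidAlgebra.of ℤ R r)) : f = g := by
  refine MonoidAlgebra.ringHom_ext (fun n => ?_) h
  have hn : (MonoidAlgebra.single 1 n : ZR R) = (n : ZR R) := by
    rw [MonoidAlgebra.intCast_def, Int.cast_id]
  rw [hn, map_intCast, map_intCast]

variable (S : LowerSet ℕ)

/-- The surjection `W(ℤR) → E_S(R)` induced by the ghost map. -/
noncomputable def wittToE : WittVector p (ZR R) →+* E p S R :=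
  (Ideal.Quotient.mk _).comp (ghostX p S (natCast_prime_mem_nonZeroDivisors_ZR p R))

theorem wittToE_surjective : Function.Surjective (wittToE p R S) :=
  Ideal.Quotient.mk_surjective.comp (ghostX_surjective p S _)

/-- The kernel of `W(ℤR) → E_S(R)` consists of the Witt vectors whose coefficients with index
in `S` lie in `I`. -/
theorem wittToE_eq_zero_iff (w : WittVector p (ZR R)) :
    wittToE p R S w = 0 ↔ ∀ i ∈ S, piZR R (w.coeff i) = 0 := by
  have hA := natCast_prime_mem_nonZeroDivisors_ZR p R
  rw [wittToE, RingHom.comp_apply, Ideal.Quotient.eq_zero_iff_mem]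
  change ghost p S w ∈ X p S (augIdeal R) ↔ _
  rw [mem_X_iff p S hA]
  constructor
  · rintro ⟨v, hv, h⟩ i hi
    rw [← coeff_eq_of_ghost_eq (S := S) hA i hi fun k _ => congrFun h k]
    exact hv i
  · intro h
    classical
    refine ⟨WittVector.mk p fun i => if i ∈ S then w.coeff i else 0, fun i => ?_,
      funext fun k => ghost_congr k fun i hi => ?_⟩
    · rw [WittVector.coeff_mk]
      split_ifs with hi
      exacts [h i hi, zero_mem _]
    · rw [WittVector.coeff_mk]
      exact if_pos (S.lower hi k.2)

variable {R} in
theorem wittToE_verTeich (i : ℕ) (r : R) :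
    wittToE p R S (WittVector.verschiebung^[i]
      (WittVector.teichmuller p (MonoidAlgebra.of ℤ R r))) = verTeichE p S i r := by
  refine congrArg (Ideal.Quotient.mk _) (Subtype.ext ?_)
  exact ghost_iterate_verschiebung_teichmuller p S i _

theorem projE_wittToE {S T : LowerSet ℕ} (h : T ≤ S) (w : WittVector p (ZR R)) :
    projE p R h (wittToE p R S w) = wittToE p R T w :=
  rfl

/-- The surjection `W(ℤR) → W(R)` induced by `π`. -/
noncomputable abbrev wittPi : WittVector p (ZR R) →+* WittVector p R :=
  WittVector.map (piZR R)

theorem piZR_surjective : Function.Surjective (piZR R) := fun r =>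
  ⟨MonoidAlgebra.of ℤ R r, liftZR_of _ _⟩

theorem wittPi_verTeich (i : ℕ) (r : R) :
    wittPi p R (WittVector.verschiebung^[i]
      (WittVector.teichmuller p (MonoidAlgebra.of ℤ R r))) =
      WittVector.verschiebung^[i] (WittVector.teichmuller p r) := by
  ext j
  rw [WittVector.map_coeff, iterate_verschiebung_teichmuller_coeff,
    iterate_verschiebung_teichmuller_coeff, apply_ite (piZR R), liftZR_of, map_zero]
  rfl

variable {p R S} in
/-- Two surjective ring homomorphisms with the same kernel have isomorphic targets. -/
theorem exists_ringEquiv_of_ker_eq {A B C : Type*} [CommRing A] [CommRing B] [CommRing C]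
    {f : A →+* B} {g : A →+* C} (hf : Function.Surjective f) (hg : Function.Surjective g)
    (h : RingHom.ker f = RingHom.ker g) : ∃ e : B ≃+* C, ∀ a, e (f a) = g a := by
  refine ⟨(RingHom.quotientKerEquivOfSurjective hf).symm.trans
    ((Ideal.quotEquivOfEq h).trans (RingHom.quotientKerEquivOfSurjective hg)), fun a => ?_⟩
  rw [← RingHom.quotientKerEquivOfSurjective_apply_mk hf a]
  simp [Ideal.quotEquivOfEq_mk]

theorem exists_ringEquiv_En (n : ℕ) : ∃ ω : En p R n ≃+* TruncatedWittVector p n R,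
    ∀ w, ω (wittToE p R (LowerSet.Iio n) w) = WittVector.truncate n (wittPi p R w) := by
  refine exists_ringEquiv_of_ker_eq (g := (WittVector.truncate n).comp (wittPi p R))
    (wittToE_surjective p R _)
    ((WittVector.truncate_surjective p n R).comp (WittVector.map_surjective _ (piZR_surjective R)))
    (Ideal.ext fun w => ?_)
  rw [RingHom.mem_ker, wittToE_eq_zero_iff, RingHom.mem_ker, RingHom.comp_apply,
    ← RingHom.mem_ker, WittVector.mem_ker_truncate]
  simp [WittVector.map_coeff]

theorem exists_ringEquiv_EInf : ∃ ω : EInf p R ≃+* WittVector p R,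
    ∀ w, ω (wittToE p R ⊤ w) = wittPi p R w := by
  refine exists_ringEquiv_of_ker_eq (wittToE_surjective p R _)
    (WittVector.map_surjective _ (piZR_surjective R)) (Ideal.ext fun w => ?_)
  rw [RingHom.mem_ker, wittToE_eq_zero_iff, RingHom.mem_ker, WittVector.ext_iff]
  simp [WittVector.map_coeff]

/-- An isomorphism `E(R) ≅ W(R)` compatible with the maps from `W(ℤR)` is a homeomorphism: the
coefficients of a Witt vector over `ℤR` and its ghost components determine each other up to any
given index. -/
theorem isHomeomorph_EInf (ω : EInf p R ≃+* WittVector p R)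
    (hω : ∀ w, ω (wittToE p R ⊤ w) = wittPi p R w) : IsHomeomorph ω := by
  have hA := natCast_prime_mem_nonZeroDivisors_ZR p R
  refine isHomeomorph_iff_exists_inverse.2
    ⟨?_, ω.symm, ω.symm_apply_apply, ω.apply_symm_apply, ?_⟩
  · refine continuous_coinduced_dom.2 (continuous_witt_rng fun k => ?_)
    refine (IsLocallyConstant.iff_exists_open _).2 fun x =>
      ⟨_, (isOpen_agree ⊤ (x : (⊤ : LowerSet ℕ) → ZR R) k).preimage continuous_subtype_val,
        fun _ _ => rfl, fun y hy => ?_⟩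
    obtain ⟨v, rfl⟩ := ghostX_surjective p ⊤ hA x
    obtain ⟨w, rfl⟩ := ghostX_surjective p ⊤ hA y
    change (ω (wittToE p R ⊤ w)).coeff k = (ω (wittToE p R ⊤ v)).coeff k
    rw [hω, hω, WittVector.map_coeff, WittVector.map_coeff,
      coeff_eq_of_ghost_eq (S := ⊤) hA k trivial hy]
  · -- the inverse is computed with the set-theoretic section `r ↦ [r]` of `π`
    let s : WittVector p R → WittVector p (ZR R) := fun x =>
      WittVector.mk p fun i => MonoidAlgebra.of ℤ R (x.coeff i)
    have hs : ∀ x, wittPi p R (s x) = x := fun x => by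
      ext i
      rw [WittVector.map_coeff, WittVector.coeff_mk, liftZR_of, MonoidHom.id_apply]
    have he : (ω.symm : WittVector p R → EInf p R) =
        fun x => Ideal.Quotient.mk _ (ghostX p ⊤ hA (s x)) := funext fun x => by
      rw [RingEquiv.symm_apply_eq]
      exact ((hω _).trans (hs x)).symm
    rw [he]
    refine continuous_coinduced_rng.comp (continuous_induced_rng.2 (continuous_pi fun k => ?_))
    refine (isLocallyConstant_witt (k : ℕ) fun x y h => ghost_congr k fun i hi => ?_).continuous
    exact congrArg (MonoidAlgebra.of ℤ R) (h i hi)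

end Comparison

/-! ### Teichmüller representatives generate `W_n(R)` -/

section Filtration

variable {p : ℕ} [hp : Fact p.Prime] {R : Type*} [CommRing R]

theorem truncate_eq_iff {n : ℕ} {x y : WittVector p R} :
    WittVector.truncate n x = WittVector.truncate n y ↔ ∀ i < n, x.coeff i = y.coeff i := by
  constructor
  · intro h i hi
    rw [← WittVector.coeff_truncate x ⟨i, hi⟩, h, WittVector.coeff_truncate]
  · intro h
    ext i
    rw [WittVector.coeff_truncate, WittVector.coeff_truncate, h i i.2]

theorem map_mem_ker_truncate {B : Type*} [CommRing B] (f : R →+* B) {n : ℕ} {x : WittVector p R}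
    (hx : x ∈ RingHom.ker (WittVector.truncate (p := p) n)) :
    WittVector.map f x ∈ RingHom.ker (WittVector.truncate (p := p) n) := by
  rw [WittVector.mem_ker_truncate] at hx ⊢
  intro i hi
  rw [WittVector.map_coeff, hx i hi, map_zero]

variable [CharP R p]

theorem mul_mem_ker_truncate {i j : ℕ} {x y : WittVector p R}
    (hx : x ∈ RingHom.ker (WittVector.truncate (p := p) i))
    (hy : y ∈ RingHom.ker (WittVector.truncate (p := p) j)) :
    x * y ∈ RingHom.ker (WittVector.truncate (p := p) (i + j)) := by
  rw [WittVector.mem_ker_truncate] at hx hy ⊢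
  rw [WittVector.eq_iterate_verschiebung hx, WittVector.eq_iterate_verschiebung hy,
    WittVector.iterate_verschiebung_mul]
  exact fun k hk => WittVector.iterate_verschiebung_coeff_eq_zero _ hk

theorem iterate_frobenius_mem_ker_truncate [IsReduced R] {m n : ℕ} {x : WittVector p R} :
    WittVector.frobenius^[m] x ∈ RingHom.ker (WittVector.truncate (p := p) n) ↔
      x ∈ RingHom.ker (WittVector.truncate (p := p) n) := by
  simp only [WittVector.mem_ker_truncate, WittVector.iterate_frobenius_coeff]
  exact forall₂_congr fun i _ => pow_eq_zero_iff (pow_pos hp.out.pos m).ne'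

/-- Congruent Witt vectors modulo `V` have congruent `p ^ n`-th powers modulo `V ^ (n + 1)`.
Applying the Frobenius turns `V` into multiplication by `p`, where this is well known. -/
theorem pow_sub_pow_mem_ker_truncate [IsReduced R] {x y : WittVector p R}
    (h : x.coeff 0 = y.coeff 0) (n : ℕ) :
    x ^ p ^ n - y ^ p ^ n ∈ RingHom.ker (WittVector.truncate (p := p) (n + 1)) := by
  have h0 : ∀ i < 1, (x - y).coeff i = 0 := fun i hi => by
    rw [Nat.lt_one_iff.1 hi, ← WittVector.constantCoeff_apply, map_sub, sub_eq_zero]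
    exact h
  have hd : (p : WittVector p R) ∣ WittVector.frobenius x - WittVector.frobenius y := by
    rw [← map_sub, WittVector.eq_iterate_verschiebung h0, Function.iterate_one,
      WittVector.frobenius_verschiebung]
    exact dvd_mul_left _ _
  obtain ⟨z, hz⟩ := dvd_sub_pow_of_dvd_sub hd n
  rw [← iterate_frobenius_mem_ker_truncate (m := 1), Function.iterate_one, map_sub, map_pow,
    map_pow, hz, mul_comm, WittVector.mem_ker_truncate]
  exact fun i hi => WittVector.mul_pow_charP_coeff_zero z hi

theorem iterate_frobenius_teichmuller (n : ℕ) (a : R) :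
    WittVector.frobenius^[n] (WittVector.teichmuller p a) = WittVector.teichmuller p a ^ p ^ n := by
  ext k
  rw [← map_pow, WittVector.iterate_frobenius_coeff]
  rcases Nat.eq_zero_or_pos k with rfl | hk
  · simp only [WittVector.teichmuller_coeff_zero]
  · rw [WittVector.teichmuller_coeff_pos _ _ _ hk, WittVector.teichmuller_coeff_pos _ _ _ hk,
      zero_pow (pow_pos hp.out.pos n).ne']

end Filtration

section Generation

open Polynomial

variable {p : ℕ} [hp : Fact p.Prime] {k : Type*} [Field k] [CharP k p]

/-- Weights `w_j ∈ W(k)` which extract the linear coefficient of a polynomial of degree at most `N`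
from its values at the Teichmüller representatives of `N + 1` distinct elements of `k`: the
Vandermonde determinant of these is a unit of `W(k)`. -/
theorem exists_weights [Infinite k] (N : ℕ) :
    ∃ (l : Fin (N + 1) → k) (w : Fin (N + 1) → WittVector p k), ∀ m < N + 1,
      ∑ j, w j * WittVector.teichmuller p (l j) ^ m = if m = 1 then 1 else 0 := by
  let l : Fin (N + 1) → k := fun j => Infinite.natEmbedding k j
  have hl : Function.Injective l := fun i j h =>
    Fin.ext ((Infinite.natEmbedding k).injective h)
  let M := Matrix.vandermonde fun j => WittVector.teichmuller p (l j)
  have hM : IsUnit M.det := by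
    rw [Matrix.det_vandermonde]
    refine (Submonoid.prod_mem (IsUnit.submonoid _)) fun i _ =>
      Submonoid.prod_mem (IsUnit.submonoid _) fun j hj => ?_
    refine WittVector.isUnit_of_coeff_zero_ne_zero _ ?_
    rw [← WittVector.constantCoeff_apply, map_sub, WittVector.constantCoeff_apply,
      WittVector.constantCoeff_apply, WittVector.teichmuller_coeff_zero,
      WittVector.teichmuller_coeff_zero, sub_ne_zero]
    exact hl.ne (Finset.mem_Ioi.1 hj).ne'
  let e : Fin (N + 1) → WittVector p k := fun m => if (m : ℕ) = 1 then 1 else 0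
  refine ⟨l, Matrix.vecMul e M⁻¹, fun m hm => ?_⟩
  have h : Matrix.vecMul (Matrix.vecMul e M⁻¹) M = e := by
    rw [Matrix.vecMul_vecMul, Matrix.nonsing_inv_mul _ hM, Matrix.vecMul_one]
  exact congrFun h ⟨m, hm⟩

/-- Modulo `V ^ (n + 1)`, the element `V ^ n [X]` of `W(k[X])` is a `W(k)`-linear combination of
Teichmüller representatives `[1 + l_j X]`. After applying the `n`-th power of the Frobenius this
follows from
`∑ w'_j [1 + l_j X] ^ (p ^ n) ≡ ∑ w'_j (1 + [l_j] [X]) ^ (p ^ n) = p ^ n [X]`,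
where the weights `w'_j = F ^ n w_j` kill all the binomial terms except the linear one. -/
theorem exists_iterate_verschiebung_teichmuller_X [Infinite k] [PerfectRing k p] (n : ℕ) :
    ∃ (l : Fin (p ^ n + 1) → k) (w : Fin (p ^ n + 1) → WittVector p k),
      WittVector.verschiebung^[n] (WittVector.teichmuller p (Polynomial.X : k[X])) -
        ∑ j, WittVector.map C (w j) * WittVector.teichmuller p (1 + C (l j) * Polynomial.X) ∈
      RingHom.ker (WittVector.truncate (p := p) (n + 1)) := by
  have hq : 0 < p ^ n := pow_pos hp.out.pos n
  obtain ⟨l, w', hw'⟩ := exists_weights (p := p) (k := k) (p ^ n)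
  choose w hw using fun j => (WittVector.frobenius_bijective p k).surjective.iterate n (w' j)
  refine ⟨l, w, ?_⟩
  have hFC : ∀ j, WittVector.frobenius^[n] (WittVector.map (C : k →+* k[X]) (w j)) =
      WittVector.map C (w' j) := fun j => by
    ext1 i
    rw [← hw, WittVector.iterate_frobenius_coeff, WittVector.map_coeff, WittVector.map_coeff,
      WittVector.iterate_frobenius_coeff, map_pow]
  have hFV : WittVector.frobenius^[n] (WittVector.verschiebung^[n]
      (WittVector.teichmuller p (Polynomial.X : k[X]))) =
      WittVector.teichmuller p Polynomial.X * (p : WittVector p k[X]) ^ n := by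
    rw [← WittVector.iterate_verschiebung_iterate_frobenius]
    exact ((WittVector.verschiebung_frobenius_comm.iterate_iterate n n) _).symm
  set t := WittVector.teichmuller p (Polynomial.X : k[X]) with ht
  have hsum : ∑ j, WittVector.map C (w' j) *
      (1 + WittVector.teichmuller p (C (l j) : k[X]) * t) ^ p ^ n =
      t * (p : WittVector p k[X]) ^ n := by
    have h1 : ∀ j, WittVector.map C (w' j) *
        (1 + WittVector.teichmuller p (C (l j) : k[X]) * t) ^ p ^ n =
        ∑ m ∈ Finset.range (p ^ n + 1), t ^ m * ((p ^ n).choose m : WittVector p k[X]) *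
          WittVector.map C (w' j * WittVector.teichmuller p (l j) ^ m) := fun j => by
      rw [add_comm, add_pow, Finset.mul_sum]
      refine Finset.sum_congr rfl fun m _ => ?_
      rw [one_pow, map_mul, map_pow, WittVector.map_teichmuller]
      ring
    simp only [h1]
    rw [Finset.sum_comm]
    simp only [← Finset.mul_sum, ← map_sum]
    rw [Finset.sum_congr rfl fun m hm => by rw [hw' m (Finset.mem_range.1 hm)]]
    rw [Finset.sum_eq_single_of_mem 1 (Finset.mem_range.2 (by omega))
      fun m _ hm => by rw [if_neg hm, map_zero, mul_zero]]
    simp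
  rw [← iterate_frobenius_mem_ker_truncate (m := n), ← RingHom.coe_pow, map_sub, map_sum]
  simp only [map_mul, RingHom.coe_pow]
  rw [hFV, ← hsum, ← Finset.sum_sub_distrib]
  refine sum_mem fun j _ => ?_
  rw [hFC, iterate_frobenius_teichmuller, ← mul_sub]
  refine Ideal.mul_mem_left _ _ (pow_sub_pow_mem_ker_truncate ?_ n)
  simp only [← WittVector.constantCoeff_apply, map_add, map_mul, map_one]
  simp [ht, WittVector.constantCoeff_apply, WittVector.teichmuller_coeff_zero]

theorem alphaW_of {R : Type*} [CommRing R] (r : R) :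
    alphaW p R (MonoidAlgebra.of ℤ R r) = WittVector.teichmuller p r :=
  liftZR_of _ r

theorem teichmuller_mem_range_alphaWn {R : Type*} [CommRing R] (n : ℕ) (r : R) :
    WittVector.truncate n (WittVector.teichmuller p r) ∈ (alphaWn p R n).range :=
  ⟨_, congrArg (WittVector.truncate n) (alphaW_of r)⟩

/-- For a perfect ring `k`, Teichmüller expansions show that `ℤk → W_n(k)` is surjective; hence the
image of `ℤR → W_n(R)` contains the image of `W(k)` for every `k`-algebra `R`. -/
theorem truncate_map_mem_range_alphaWn {k : Type*} [CommRing k] [CharP k p] [PerfectRing k p]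
    {R : Type*} [CommRing R] (f : k →+* R) (n : ℕ) (w : WittVector p k) :
    WittVector.truncate n (WittVector.map f w) ∈ (alphaWn p R n).range := by
  obtain ⟨z, hz⟩ := WittVector.dvd_sub_sum_teichmuller_iterateFrobeniusEquiv_coeff w n
  have h0 : WittVector.map f ((p : WittVector p k) ^ (n + 1) * z) ∈
      RingHom.ker (WittVector.truncate (p := p) n) := by
    refine map_mem_ker_truncate f ?_
    rw [mul_comm, WittVector.mem_ker_truncate]
    exact fun i hi => WittVector.mul_pow_charP_coeff_zero z (by omega)
  rw [← sub_add_cancel w, hz, map_add, map_add, RingHom.mem_ker.1 h0, zero_add, map_sum, map_sum]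
  refine sum_mem fun i _ => ?_
  rw [map_mul, map_mul, WittVector.map_teichmuller, map_pow, map_pow, map_natCast, map_natCast]
  exact mul_mem (teichmuller_mem_range_alphaWn _ _) (pow_mem (natCast_mem _ _) _)

variable (p k) in
theorem iterate_verschiebung_teichmuller_mem_range_alphaWn [Infinite k] [PerfectRing k p]
    {R : Type*} [CommRing R] [Algebra k R] (n : ℕ) (r : R) :
    WittVector.truncate (n + 1) (WittVector.verschiebung^[n] (WittVector.teichmuller p r)) ∈
      (alphaWn p R (n + 1)).range := by
  obtain ⟨l, w, h⟩ := exists_iterate_verschiebung_teichmuller_X (p := p) (k := k) n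
  let f : k[X] →+* R := (aeval r).toRingHom
  have hfX : WittVector.map f (WittVector.verschiebung^[n] (WittVector.teichmuller p (Polynomial.X : k[X]))) =
      WittVector.verschiebung^[n] (WittVector.teichmuller p r) := by
    ext j
    rw [WittVector.map_coeff, iterate_verschiebung_teichmuller_coeff,
      iterate_verschiebung_teichmuller_coeff, apply_ite f, map_zero]
    simp [f]
  have hfC : ∀ j, WittVector.map f (WittVector.map C (w j)) =
      WittVector.map (algebraMap k R) (w j) := fun j => by
    ext j
    simp [f, WittVector.map_coeff]
  have h2 := map_mem_ker_truncate f h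
  rw [map_sub, RingHom.mem_ker, map_sub, sub_eq_zero, hfX] at h2
  rw [h2, map_sum, map_sum]
  refine sum_mem fun j _ => ?_
  rw [map_mul, map_mul, hfC, WittVector.map_teichmuller]
  exact mul_mem (truncate_map_mem_range_alphaWn _ _ _) (teichmuller_mem_range_alphaWn _ _)

variable (p k) in
/-- The map `ℤR → W_n(R)` is surjective for every algebra `R` over an infinite perfect field of
characteristic `p`. -/
theorem alphaWn_surjective [Infinite k] [PerfectRing k p]
    (R : Type*) [CommRing R] [Algebra k R] (n : ℕ) : Function.Surjective (alphaWn p R n) := by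
  suffices h : ∀ x : WittVector p R, ∃ a,
      WittVector.truncate n (alphaW p R a) = WittVector.truncate n x by
    intro y
    obtain ⟨x, rfl⟩ := WittVector.truncate_surjective p n R y
    exact h x
  intro x
  induction n with
  | zero => exact ⟨0, truncate_eq_iff.2 fun i hi => absurd hi (Nat.not_lt_zero i)⟩
  | succ n ih =>
    obtain ⟨a, ha⟩ := ih
    have h1 : x - alphaW p R a ∈ RingHom.ker (WittVector.truncate (p := p) n) := by
      rw [RingHom.mem_ker, map_sub, ha, sub_self]
    have h2 := WittVector.eq_iterate_verschiebung ((WittVector.mem_ker_truncate _ _).1 h1)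
    set y := (x - alphaW p R a).shift n
    obtain ⟨b, hb⟩ := iterate_verschiebung_teichmuller_mem_range_alphaWn p k n (y.coeff 0)
    have h3 : WittVector.truncate (n + 1) (WittVector.verschiebung^[n] y) =
        WittVector.truncate (n + 1)
          (WittVector.verschiebung^[n] (WittVector.teichmuller p (y.coeff 0))) := by
      refine truncate_eq_iff.2 fun i hi => ?_
      rcases (Nat.lt_succ_iff.1 hi).lt_or_eq with hi | rfl
      · rw [WittVector.iterate_verschiebung_coeff_eq_zero _ hi,
          WittVector.iterate_verschiebung_coeff_eq_zero _ hi]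
      · have := WittVector.iterate_verschiebung_coeff y i 0
        rw [zero_add] at this
        rw [this, iterate_verschiebung_teichmuller_coeff, if_pos rfl]
    refine ⟨a + b, ?_⟩
    rw [← sub_add_cancel x (alphaW p R a), h2, map_add, map_add, map_add, h3, ← hb]
    exact add_comm _ _

end Generation

/-! ### The kernel of `ℤR → W_n(R)` -/

section Kernel

theorem frobZR_pow_of (p : ℕ) (R : Type*) [CommRing R] (m : ℕ) (r : R) :
    (frobZR p R ^ m) (MonoidAlgebra.of ℤ R r) = MonoidAlgebra.of ℤ R r ^ p ^ m := by
  induction m with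
  | zero => simp
  | succ m ih => rw [pow_succ', RingHom.mul_def, RingHom.comp_apply, ih, map_pow,
      show frobZR p R (MonoidAlgebra.of ℤ R r) = MonoidAlgebra.of ℤ R (r ^ p) by simp [frobZR],
      map_pow, ← pow_mul, pow_succ']

variable (p : ℕ) [hp : Fact p.Prime] (R : Type*) [CommRing R]

/-- The ring homomorphism `ℤR → W(ℤR)` with `[r] ↦ [[r]]`, the Teichmüller representative of the
symbol `[r]`. It lifts `ℤR → W(R)`. -/
noncomputable def teichZR : ZR R →+* WittVector p (ZR R) :=
  liftZR ((WittVector.teichmuller p).comp (MonoidAlgebra.of ℤ R))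

theorem wittPi_teichZR (a : ZR R) : wittPi p R (teichZR p R a) = alphaW p R a := by
  refine RingHom.congr_fun (f := (wittPi p R).comp (teichZR p R)) (ZR_hom_ext fun r => ?_) a
  rw [RingHom.comp_apply, teichZR, liftZR_of, alphaW_of]
  exact wittPi_verTeich p R 0 r

/-- The ghost components of the lift of `a` to `W(ℤR)` are `a, φ a, φ ^ 2 a, …`. -/
theorem ghostComponent_teichZR (m : ℕ) (a : ZR R) :
    WittVector.ghostComponent m (teichZR p R a) = (frobZR p R ^ m) a := by
  refine RingHom.congr_fun (f := (WittVector.ghostComponent m).comp (teichZR p R))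
    (ZR_hom_ext fun r => ?_) a
  rw [RingHom.comp_apply, teichZR, liftZR_of, frobZR_pow_of]
  exact (congrFun (ghost_iterate_verschiebung_teichmuller p ⊤ 0 (MonoidAlgebra.of ℤ R r))
    ⟨m, trivial⟩).trans (by simp [verTeich])

variable {p R}

/-- If `a` maps to zero in `W_n(R)`, then `φ ^ (n - 1) a = ∑ p ^ i w_i ^ (p ^ (n - 1 - i))` with
`w_i ∈ I`. Since `p ∈ I` and `p ^ m ≥ m + 1`, every summand lies in `I ^ n`. -/
theorem frobZR_pow_mem_of_alphaWn_eq_zero (hR : (p : R) = 0) {n : ℕ} {a : ZR R}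
    (ha : alphaWn p R (n + 1) a = 0) : (frobZR p R ^ n) a ∈ augIdeal R ^ (n + 1) := by
  have hw : ∀ i < n + 1, (teichZR p R a).coeff i ∈ augIdeal R := fun i hi => by
    have := (WittVector.mem_ker_truncate (n + 1) (alphaW p R a)).1 ha i hi
    rwa [← wittPi_teichZR, WittVector.map_coeff] at this
  have hpI : (p : ZR R) ∈ augIdeal R := by
    rw [augIdeal, RingHom.mem_ker, map_natCast, hR]
  rw [← ghostComponent_teichZR, WittVector.ghostComponent_apply, aeval_wittPolynomial]
  refine sum_mem fun i hi => ?_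
  have hi' := Finset.mem_range.1 hi
  have hlt : n - i < p ^ (n - i) := Nat.lt_pow_self hp.out.one_lt
  refine Ideal.pow_le_pow_right (m := n + 1) (n := i + p ^ (n - i)) (by omega) ?_
  rw [pow_add]
  exact Ideal.mul_mem_mul (Ideal.pow_mem_pow hpI i) (Ideal.pow_mem_pow (hw i hi') _)

theorem alphaW_frobZR_pow [CharP R p] (m : ℕ) (a : ZR R) :
    alphaW p R ((frobZR p R ^ m) a) = WittVector.frobenius^[m] (alphaW p R a) := by
  rw [← RingHom.coe_pow]
  refine RingHom.congr_fun (f := (alphaW p R).comp (frobZR p R ^ m))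
    (g := (WittVector.frobenius ^ m).comp (alphaW p R)) (ZR_hom_ext fun r => ?_) a
  rw [RingHom.comp_apply, RingHom.comp_apply, frobZR_pow_of, RingHom.coe_pow, map_pow, alphaW_of,
    iterate_frobenius_teichmuller]

theorem augIdeal_pow_le_ker_alphaWn [CharP R p] (n : ℕ) :
    augIdeal R ^ n ≤ RingHom.ker (alphaWn p R n) := by
  change _ ≤ (RingHom.ker (WittVector.truncate (p := p) n)).comap (alphaW p R)
  induction n with
  | zero =>
    intro a _
    exact (WittVector.mem_ker_truncate _ _).2 fun i hi => absurd hi (Nat.not_lt_zero i)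
  | succ n ih =>
    rw [pow_succ]
    refine Ideal.mul_le.2 fun a ha b hb => ?_
    rw [Ideal.mem_comap, map_mul]
    refine mul_mem_ker_truncate (ih ha) ((WittVector.mem_ker_truncate _ _).2 fun i hi => ?_)
    rw [Nat.lt_one_iff.1 hi]
    -- the zeroth coefficient of `ℤR → W(R)` is `π`
    have h0 : WittVector.constantCoeff.comp (alphaW p R) = piZR R := ZR_hom_ext fun r => by
      rw [RingHom.comp_apply, alphaW_of, liftZR_of, WittVector.constantCoeff_apply,
        WittVector.teichmuller_coeff_zero, MonoidHom.id_apply]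
    exact (RingHom.congr_fun h0 b).trans hb

/-- If the Frobenius of `R` is injective, then `I_n` is the kernel of `ℤR → W_n(R)`. -/
theorem frobIdeal_eq_ker (hR : (p : R) = 0) (hinj : Function.Injective fun r : R => r ^ p)
    (n : ℕ+) : frobIdeal p R n = RingHom.ker (alphaWn p R n) := by
  refine le_antisymm (fun a ha => ?_) fun a ha => ?_
  · -- the zero ring does not have characteristic `p`
    rcases subsingleton_or_nontrivial R with hs | hs
    · exact TruncatedWittVector.ext fun i => Subsingleton.elim _ _
    have : CharP R p := (CharP.charP_iff_prime_eq_zero hp.out).2 hR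
    have : IsReduced R := (isReduced_iff_pow_one_lt p hp.out.one_lt).2 fun x hx =>
      hinj (hx.trans (zero_pow hp.out.ne_zero).symm)
    have h := augIdeal_pow_le_ker_alphaWn (p := p) (n : ℕ) ha
    change alphaW p R _ ∈ RingHom.ker (WittVector.truncate (p := p) n) at h
    rw [alphaW_frobZR_pow, iterate_frobenius_mem_ker_truncate] at h
    exact h
  · have hn : (n : ℕ) - 1 + 1 = n := Nat.succ_pred_eq_of_pos n.pos
    have := frobZR_pow_mem_of_alphaWn_eq_zero hR (n := (n : ℕ) - 1) (a := a) (by rw [hn]; exact ha)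
    rwa [hn] at this

theorem antitone_ker_alphaWn : Antitone fun n : ℕ => RingHom.ker (alphaWn p R n) := by
  intro m n h a ha
  change alphaW p R a ∈ RingHom.ker (WittVector.truncate (p := p) n) at ha
  change alphaW p R a ∈ RingHom.ker (WittVector.truncate (p := p) m)
  rw [WittVector.mem_ker_truncate] at ha ⊢
  exact fun i hi => ha i (hi.trans_le h)

end Kernel

/-! ### The projective limit -/

section Limit

variable {p : ℕ} [hp : Fact p.Prime] {R : Type*} [CommRing R]

/-- Compatible isomorphisms `ℤR / J_n ≅ W_n(R)` induced by `ℤR → W_n(R)` give an isomorphism of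
topological rings between `lim ℤR / J_n` and `W(R)`. -/
theorem exists_quotLim_ringEquiv (J : ℕ+ → Ideal (ZR R)) (hJ : Antitone J)
    (β : ∀ n : ℕ+, (ZR R ⧸ J n) ≃+* TruncatedWittVector p n R)
    (hβ : ∀ n a, β n (Ideal.Quotient.mk _ a) = alphaWn p R n a) :
    ∃ e : quotLim J hJ ≃+* WittVector p R, IsHomeomorph e ∧
      ∀ (n : ℕ+) (x : quotLim J hJ), WittVector.truncate n (e x) = β n (x.1 n) := by
  -- transition maps correspond to truncation
  have hcoeff : ∀ (i j : ℕ+) (h : i ≤ j) (y : ZR R ⧸ J j) (k : ℕ) (hi : k < i) (hj : k < j),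
      (β i (Ideal.Quotient.factor (hJ h) y)).coeff ⟨k, hi⟩ = (β j y).coeff ⟨k, hj⟩ := by
    intro i j h y k hi hj
    obtain ⟨a, rfl⟩ := Ideal.Quotient.mk_surjective y
    rw [Ideal.Quotient.factor_mk, hβ, hβ]
    exact (WittVector.coeff_truncate (alphaW p R a) ⟨k, hi⟩).trans
      (WittVector.coeff_truncate (alphaW p R a) ⟨k, hj⟩).symm
  let g : WittVector p R →+* quotLim J hJ :=
    (RingHom.pi fun n : ℕ+ => (β n).symm.toRingHom.comp (WittVector.truncate n)).codRestrict _
      fun x i j h => by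
        apply (β i).injective
        ext k
        rw [hcoeff i j h _ k k.2 (k.2.trans_le h)]
        simp only [RingHom.pi_apply, RingHom.comp_apply]
        refine (congrArg _ ((β j).apply_symm_apply _)).trans
          (.trans ?_ (congrArg _ ((β i).apply_symm_apply _)).symm)
        rw [WittVector.coeff_truncate, WittVector.coeff_truncate]
  have hg : ∀ (x : WittVector p R) (n : ℕ+), β n ((g x).1 n) = WittVector.truncate n x :=
    fun x n => (β n).apply_symm_apply _
  -- the inverse map, reading off the coefficient `k` in `W_(k+1)(R)`
  let f : quotLim J hJ → WittVector p R := fun x =>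
    WittVector.mk p fun k => (β k.succPNat (x.1 k.succPNat)).coeff ⟨k, Nat.lt_succ_self k⟩
  have hf : ∀ (x : quotLim J hJ) (n : ℕ+), WittVector.truncate n (f x) = β n (x.1 n) := by
    intro x n
    ext k
    rw [WittVector.coeff_truncate, WittVector.coeff_mk]
    have hkn : (k : ℕ).succPNat ≤ n := Nat.succ_le_of_lt k.2
    rw [← x.2 _ n hkn]
    exact hcoeff _ _ hkn _ k _ k.2
  have hgf : ∀ x, g (f x) = x := fun x => Subtype.ext (funext fun n =>
    (β n).injective ((hg _ n).trans (hf x n)))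
  have hfg : ∀ x, f (g x) = x := fun x => WittVector.ext fun k => by
    have := hf (g x) k.succPNat
    rw [hg, truncate_eq_iff] at this
    exact this k (Nat.lt_succ_self k)
  have hd : ∀ n, DiscreteTopology (ZR R ⧸ J n) := fun n =>
    discreteTopology_iff_forall_isOpen.2 fun s => isOpen_coinduced.2 (isOpen_discrete _)
  let e : quotLim J hJ ≃+* WittVector p R :=
    (RingEquiv.ofBijective g ⟨Function.LeftInverse.injective hfg,
      Function.RightInverse.surjective hgf⟩).symm
  have he : ∀ x, e x = f x := fun x => by
    rw [RingEquiv.symm_apply_eq]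
    exact (hgf x).symm
  refine ⟨e, isHomeomorph_iff_exists_inverse.2 ⟨?_, e.symm, e.symm_apply_apply,
    e.apply_symm_apply, ?_⟩, fun n x => by rw [he, hf]⟩
  · rw [funext he]
    refine continuous_witt_rng fun k => ?_
    have h1 : Continuous fun x : quotLim J hJ => x.1 k.succPNat :=
      (continuous_apply _).comp continuous_subtype_val
    exact ((IsLocallyConstant.iff_continuous _).2 h1).comp fun y =>
      (β k.succPNat y).coeff ⟨k, Nat.lt_succ_self k⟩
  · refine continuous_induced_rng.2 (continuous_pi fun n => ?_)
    refine (isLocallyConstant_witt (n : ℕ) fun x y h => ?_).continuous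
    exact congrArg (β n).symm (truncate_eq_iff.2 fun i hi => h i hi.le)

end Limit

end CuntzDeninger

open CuntzDeninger in
theorem theorem7p2 (p : ℕ) [Fact p.Prime] (R : Type*) [CommRing R]
    [Algebra (AlgebraicClosure (ZMod p)) R] :
    -- the canonical identifications `E_n(R) ≅ W_n(R)` and `E(R) ≅ W(R)`
    (∀ n : ℕ+, ∃ ω : En p R n ≃+* TruncatedWittVector p n R,
      ∀ (i : ℕ) (r : R), ω (verTeichE p (LowerSet.Iio (n : ℕ)) i r) =
        WittVector.truncate n (WittVector.verschiebung^[i] (WittVector.teichmuller p r))) ∧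
    (∃ ω : EInf p R ≃+* WittVector p R, IsHomeomorph ω ∧
      ∀ (i : ℕ) (r : R), ω (verTeichE p ⊤ i r) =
        WittVector.verschiebung^[i] (WittVector.teichmuller p r)) ∧
    -- surjectivity of `ℤR → E_n(R)` and `ℤR → W_n(R)`
    (∀ n : ℕ+, Function.Surjective (alpha p (LowerSet.Iio (n : ℕ)) R) ∧
      Function.Surjective (alphaWn p R n)) ∧
    (Function.Injective (fun r : R => r ^ p) →
      ∃ hI : Antitone (frobIdeal p R),
        -- the isomorphisms `β_n : ℤR / I_n ≅ E_n(R)` and `lim ℤR / I_n ≅ E(R)`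
        (∃ β : ∀ n : ℕ+, (ZR R ⧸ frobIdeal p R n) ≃+* En p R n,
          (∀ n a, β n (Ideal.Quotient.mk _ a) = alpha p (LowerSet.Iio (n : ℕ)) R a) ∧
          ∃ αhat : quotLim (frobIdeal p R) hI ≃+* EInf p R, IsHomeomorph αhat ∧
            ∀ (n : ℕ+) (x : quotLim (frobIdeal p R) hI),
              projE p R (le_top : LowerSet.Iio (n : ℕ) ≤ ⊤) (αhat x) = β n (x.1 n)) ∧
        -- the isomorphisms `β_n : ℤR / I_n ≅ W_n(R)` and `lim ℤR / I_n ≅ W(R)`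
        (∃ β : ∀ n : ℕ+, (ZR R ⧸ frobIdeal p R n) ≃+* TruncatedWittVector p n R,
          (∀ n a, β n (Ideal.Quotient.mk _ a) = alphaWn p R n a) ∧
          ∃ αhat : quotLim (frobIdeal p R) hI ≃+* WittVector p R, IsHomeomorph αhat ∧
            ∀ (n : ℕ+) (x : quotLim (frobIdeal p R) hI),
              WittVector.truncate n (αhat x) = β n (x.1 n))) := by
  have hR : (p : R) = 0 := by
    rw [← map_natCast (algebraMap (AlgebraicClosure (ZMod p)) R), CharP.cast_eq_zero, map_zero]
  choose ω hω using fun n : ℕ+ => exists_ringEquiv_En p R n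
  obtain ⟨ω', hω'⟩ := exists_ringEquiv_EInf p R
  have hVω : ∀ (n : ℕ+) (i : ℕ) (r : R), ω n (verTeichE p (LowerSet.Iio (n : ℕ)) i r) =
      WittVector.truncate n (WittVector.verschiebung^[i] (WittVector.teichmuller p r)) :=
    fun n i r => by rw [← wittToE_verTeich, hω, wittPi_verTeich]
  have hαω : ∀ (n : ℕ+) (a : ZR R),
      ω n (alpha p (LowerSet.Iio (n : ℕ)) R a) = alphaWn p R n a := fun n a => by
    refine RingHom.congr_fun
      (f := (ω n).toRingHom.comp (alpha p (LowerSet.Iio (n : ℕ)) R)) (ZR_hom_ext fun r => ?_) a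
    refine (congrArg (ω n) (liftZR_of _ r)).trans ((hVω n 0 r).trans ?_)
    exact congrArg _ (alphaW_of r).symm
  have hproj : ∀ (n : ℕ+) (x : EInf p R),
      ω n (projE p R (le_top : LowerSet.Iio (n : ℕ) ≤ ⊤) x) = WittVector.truncate n (ω' x) := by
    intro n x
    obtain ⟨w, rfl⟩ := wittToE_surjective p R ⊤ x
    rw [projE_wittToE, hω, hω']
  have hsurj : ∀ n : ℕ, Function.Surjective (alphaWn p R n) :=
    alphaWn_surjective p (AlgebraicClosure (ZMod p)) R
  have hhom := isHomeomorph_EInf p R ω' hω'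
  refine ⟨fun n => ⟨ω n, hVω n⟩, ⟨ω', hhom, fun i r => ?_⟩, fun n => ⟨fun y => ?_, hsurj n⟩,
    fun hinj => ?_⟩
  · rw [← wittToE_verTeich, hω', wittPi_verTeich]
  · obtain ⟨a, ha⟩ := hsurj n (ω n y)
    exact ⟨a, (ω n).injective ((hαω n a).trans ha)⟩
  have hker := frobIdeal_eq_ker hR hinj
  have hI : Antitone (frobIdeal p R) := fun m n h => by
    rw [hker, hker]
    exact antitone_ker_alphaWn h
  let β : ∀ n : ℕ+, (ZR R ⧸ frobIdeal p R n) ≃+* TruncatedWittVector p n R := fun n =>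
    (Ideal.quotEquivOfEq (hker n)).trans (RingHom.quotientKerEquivOfSurjective (hsurj n))
  have hβ : ∀ n a, β n (Ideal.Quotient.mk _ a) = alphaWn p R n a := fun n a => rfl
  obtain ⟨e, he, hec⟩ := exists_quotLim_ringEquiv _ hI β hβ
  refine ⟨hI, ⟨fun n => (β n).trans (ω n).symm, fun n a => ?_, e.trans ω'.symm, ?_,
    fun n x => ?_⟩, β, hβ, e, he, hec⟩
  · exact (RingEquiv.symm_apply_eq _).2 ((hβ n a).trans (hαω n a).symm)
  · have hsymm : (ω'.symm : WittVector p R → EInf p R) = hhom.homeomorph.symm := funext fun y =>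
      hhom.homeomorph.injective
        ((ω'.apply_symm_apply y).trans (hhom.homeomorph.apply_symm_apply y).symm)
    have h := hhom.homeomorph.symm.isHomeomorph.comp he
    rwa [← hsymm] at h
  · refine (RingEquiv.eq_symm_apply _).2 ?_
    rw [hproj]
    exact (congrArg _ (ω'.apply_symm_apply _)).trans (hec n x)
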